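/- Conventions. Ideals are two-sided. For a complex Hilbert space $H$, $L(H)$ and $K(H)$ denote the $C^*$-algebras of the bounded and of the compact linear operators on $H$. The direct sum $\oplus_{t} \mathcal{K}_t$ of $C^*$-algebras consists of the families $(k_t)$ with $k_t \in \mathcal{K}_t$ such that $\{t : \|k_t\| \ge \varepsilon\}$ is finite for every $\varepsilon > 0$, with pointwise operations and the supremum norm. A $C^*$-algebra is elementary if it is $^*$-isomorphic to $K(H)$ for some nonzero Hilbert space $H$, and dual if it is $^*$-isomorphic to a direct sum of elementary $C^*$-algebras. A closed ideal of a $C^*$-algebra is called elementary (respectively dual) if it has this property when considered as a $C^*$-algebra. A unital representation $W : \mathcal{A} \to L(H)$ of a unital $C^*$-algebra is irreducible if $H \neq \{0\}$ and $\{0\}$ and $H$ are the only closed subspaces of $H$ that are invariant under all $W(a)$; it lifts a closed ideal $\mathcal{J}$ if its restriction to $\mathcal{J}$ is injective. An operator is Fredholm if it has closed range, finite-dimensional kernel and finite-dimensional cokernel. Theorem (Lifting theorem for dual ideals). Let $\mathcal{A}$ be a unital $C^*$-algebra. For every element $t$ of a set $T$, let $\mathcal{J}_t$ be an elementary ideal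 of $\mathcal{A}$ such that $\mathcal{J}_s \neq \mathcal{J}_t$ whenever $s \neq t$, and let $W_t : \mathcal{A} \to L(H_t)$ be an irreducible representation of $\mathcal{A}$ which lifts $\mathcal{J}_t$. Let $\mathcal{J}$ be the smallest closed ideal of $\mathcal{A}$ which contains all ideals $\mathcal{J}_t$. Then $\mathcal{J}$ is a dual ideal of $\mathcal{A}$; an element $a \in \mathcal{A}$ is invertible if and only if the coset $a + \mathcal{J}$ is invertible in $\mathcal{A}/\mathcal{J}$ and all operators $W_t(a)$, $t \in T$, are invertible; and moreover: (a) If $t_1, \ldots, t_m \in T$ and $t_i \neq t_j$ for $i \neq j$, then $(\mathcal{J}_{t_1} + \ldots + \mathcal{J}_{t_{m-1}}) \cap \mathcal{J}_{t_m} = \{0\}$. (b) $W_s(\mathcal{J}_t) = \{0\}$ whenever $s \neq t$. (c) If $j \in \mathcal{J}$, then $W_t(j)$ is compact for every $t \in T$, and the set of all $t \in T$ with $\|W_t(j)\| \ge \varepsilon$ is finite for every $\varepsilon > 0$. (d) If $a \in \mathcal{A}$ and the coset $a + \mathcal{J}$ is invertible in $\mathcal{A}/\mathcal{J}$, then $W_t(a)$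 is Fredholm for every $t \in T$, and the set of all $t \in T$ for which $W_t(a)$ is not invertible is finite. (e) The product $a \mapsto (W_t(a))_{t \in T}$ restricts to a $^*$-isomorphism from $\mathcal{J}$ onto the direct sum $\oplus_{t \in T} K(H_t)$. -/

import Mathlib

open scoped ENNReal

universe u v w

section CompactOperators

variable {H : Type*} [NormedAddCommGroup H] [InnerProductSpace ℂ H] [CompleteSpace H]

/-- The adjoint of a compact operator on a Hilbert space is compact. -/
theorem isCompactOperator_star {S : H →L[ℂ] H} (hS : IsCompactOperator S) :
    IsCompactOperator (star S : H →L[ℂ] H) := by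
  rw [ContinuousLinearMap.star_eq_adjoint]
  set R : H →L[ℂ] H := ContinuousLinearMap.adjoint S with hR
  have hC : IsCompactOperator (S ∘L R) := hS.comp_clm R
  have hC' : IsCompact (closure ((S ∘L R) '' Metric.closedBall 0 1)) :=
    IsCompactOperator.isCompact_closure_image_closedBall
      (f := ((S ∘L R : H →L[ℂ] H) : H →ₗ[ℂ] H)) hC 1
  have hTB : TotallyBounded ((S ∘L R) '' Metric.closedBall (0 : H) 1) :=
    hC'.totallyBounded.subset subset_closure
  have key : TotallyBounded (R '' Metric.closedBall (0 : H) 1) := by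
    rw [Metric.totallyBounded_iff]
    intro ε hε
    obtain ⟨t', ht's, ht'f, hcov⟩ := Set.exists_subset_image_finite_and.1
      (Metric.finite_approx_of_totallyBounded hTB (ε ^ 2 / 4) (by positivity))
    refine ⟨R '' t', ht'f.image _, ?_⟩
    rintro _ ⟨x, hx, rfl⟩
    have hx' := hcov ⟨x, hx, rfl⟩
    simp only [Set.mem_iUnion, Set.mem_image, exists_prop] at hx' ⊢
    obtain ⟨_, ⟨y, hy, rfl⟩, hxy⟩ := hx'
    refine ⟨R y, ⟨y, hy, rfl⟩, ?_⟩
    have hy1 := ht's hy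
    rw [mem_closedBall_zero_iff] at hx hy1
    rw [Metric.mem_ball, dist_eq_norm, ← map_sub] at hxy ⊢
    have h1 : ‖R (x - y)‖ ^ 2 ≤ ‖(S ∘L R) (x - y)‖ * ‖x - y‖ := by
      have h2 : inner ℂ (R (x - y)) (R (x - y)) = inner ℂ (x - y) (S (R (x - y))) := by
        rw [hR, ContinuousLinearMap.adjoint_inner_left]
      have h3 : ‖R (x - y)‖ ^ 2 = ‖inner ℂ (R (x - y)) (R (x - y))‖ := by
        rw [inner_self_eq_norm_sq_to_K]
        simp
      rw [h3, h2, mul_comm]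
      exact norm_inner_le_norm _ _
    have h4 : ‖x - y‖ ≤ 2 := (norm_sub_le _ _).trans (by linarith)
    have h5 : ‖R (x - y)‖ ^ 2 < ε ^ 2 := by
      nlinarith [norm_nonneg ((S ∘L R) (x - y)), norm_nonneg (x - y)]
    exact lt_of_pow_lt_pow_left₀ 2 hε.le h5
  exact (isCompactOperator_iff_isCompact_closure_image_closedBall
    (R : H →ₗ[ℂ] H) one_pos).2 
      (isCompact_iff_totallyBounded_isComplete.2 ⟨key.closure, isClosed_closure.isComplete⟩)

variable (H) in
/-- The C⋆-algebra `K(H)` of the compact operators on the Hilbert space `H`. -/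
def compactOperators : NonUnitalStarSubalgebra ℂ (H →L[ℂ] H) where
  carrier := {S | IsCompactOperator S}
  zero_mem' := isCompactOperator_zero
  add_mem' hS hR := IsCompactOperator.add hS hR
  smul_mem' c _ hS := IsCompactOperator.smul hS c
  mul_mem' {_ R} hS _ := IsCompactOperator.comp_clm hS R
  star_mem' hS := isCompactOperator_star hS

instance compactOperators_isClosed :
    IsClosed (compactOperators H : Set (H →L[ℂ] H)) :=
  isClosed_setOfPred_isCompactOperator

end CompactOperators

/-- The direct sum of a family of C⋆-algebras: all bounded families `x` whose norms vanish at
infinity, i.e. such that `‖x i‖ ≥ ε` for only finitely many `i`, for every `ε > 0`. -/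
def directSumCStar {I : Type*} (K : I → Type*) [∀ i, NonUnitalCStarAlgebra (K i)] :
    NonUnitalStarSubalgebra ℂ (lp K ∞) where
  carrier := {x | ∀ ε : ℝ, 0 < ε → {i | ε ≤ ‖x i‖}.Finite}
  zero_mem' ε hε := by
    have : {i | ε ≤ ‖(0 : lp K ∞) i‖} = ∅ := by
      ext i
      simp [hε]
    rw [this]
    exact Set.finite_empty
  add_mem' {x y} hx hy ε hε := by
    refine ((hx (ε / 2) (by positivity)).union (hy (ε / 2) (by positivity))).subset ?_
    intro i hi
    by_contra h
    simp only [Set.mem_union, Set.mem_ofPred_eq, not_or, not_le] at h hi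
    have : ‖(x + y : lp K ∞) i‖ ≤ ‖x i‖ + ‖y i‖ := norm_add_le _ _
    linarith
  smul_mem' c x hx ε hε := by
    refine (hx (ε / (‖c‖ + 1)) (by positivity)).subset ?_
    intro i hi
    simp only [Set.mem_ofPred_eq] at hi ⊢
    have h1 : ‖(c • x : lp K ∞) i‖ ≤ ‖c‖ * ‖x i‖ := norm_smul_le _ _
    rw [div_le_iff₀ (by positivity)]
    nlinarith [norm_nonneg (x i)]
  mul_mem' {x y} hx hy ε hε := by
    refine (hx (ε / (‖y‖ + 1)) (by positivity)).subset ?_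
    intro i hi
    simp only [Set.mem_ofPred_eq] at hi ⊢
    have h1 : ‖(x * y : lp K ∞) i‖ ≤ ‖x i‖ * ‖y i‖ := norm_mul_le _ _
    have h2 : ‖y i‖ ≤ ‖y‖ := lp.norm_apply_le_norm (by simp) y i
    rw [div_le_iff₀ (by positivity)]
    nlinarith [norm_nonneg (x i)]
  star_mem' {x} hx ε hε := by
    refine (hx ε hε).subset ?_
    intro i hi
    simp only [Set.mem_ofPred_eq, lp.star_apply, norm_star] at hi ⊢
    exact hi

/-- A C⋆-algebra is elementary if it is ⋆-isomorphic to `K(H)` for some nonzero Hilbert space `H`.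
(Such an `H` embeds isometrically in `K(H)`, so the universe of `H` is no restriction.) -/
def IsElementary (B : Type u) [NonUnitalCStarAlgebra B] : Prop :=
  ∃ (H : Type u) (_ : NormedAddCommGroup H) (_ : InnerProductSpace ℂ H) (_ : CompleteSpace H),
    Nontrivial H ∧ Nonempty (B ≃⋆ₐ[ℂ] compactOperators H)

/-- A C⋆-algebra is dual if it is ⋆-isomorphic to a direct sum of elementary C⋆-algebras. -/
def IsDual (B : Type u) [NonUnitalCStarAlgebra B] : Prop :=
  ∃ (I : Type u) (K : I → Type u) (_ : ∀ i, NonUnitalCStarAlgebra (K i)),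
    (∀ i, IsElementary (K i)) ∧ Nonempty (B ≃⋆ₐ[ℂ] directSumCStar K)

section Ideals

variable {A : Type u} [CStarAlgebra A]

/-- A closed two-sided ideal of a C⋆-algebra is stable under the involution. -/
theorem star_mem_of_isClosed (J : TwoSidedIdeal A) (hJ : IsClosed (J : Set A)) {x : A}
    (hx : x ∈ J) : star x ∈ J := by
  change star x ∈ (J : Set A)
  rw [← hJ.closure_eq, Metric.mem_closure_iff]
  intro ε hε
  set a : A := star x * x with ha
  have haJ : a ∈ J := J.mul_mem_left _ _ hx
  have hsa : IsSelfAdjoint a := IsSelfAdjoint.star_mul_self x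
  let f : ℝ → ℝ := fun t => (ε ^ 2) ^ 2 / ((ε ^ 2) ^ 2 + t ^ 2)
  let g : ℝ → ℝ := fun t => t / ((ε ^ 2) ^ 2 + t ^ 2)
  have hpos : ∀ t : ℝ, 0 < (ε ^ 2) ^ 2 + t ^ 2 := fun t => by positivity
  have hf : Continuous f := by
    refine Continuous.div continuous_const (by fun_prop) fun t => (hpos t).ne'
  have hg : Continuous g := by
    refine Continuous.div continuous_id (by fun_prop) fun t => (hpos t).ne'
  have hsplit : cfc f a + a * cfc g a = 1 := by
    have h1 : a * cfc g a = cfc (fun t => t * g t) a := by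
      conv_lhs => rw [show a * cfc g a = cfc (fun t : ℝ => t) a * cfc g a by rw [cfc_id' ℝ a]]
      rw [← cfc_mul (fun t : ℝ => t) g a (by fun_prop) hg.continuousOn]
    rw [h1, ← cfc_add a f _ hf.continuousOn (by fun_prop), ← cfc_one ℝ a]
    congr 1
    ext t
    have := (hpos t).ne'
    simp only [f, g, Pi.one_apply]
    field_simp
  have hfsa : star (cfc f a) = cfc f a := (cfc_predicate f a : IsSelfAdjoint _).star_eq
  have hnorm : ‖cfc f a * star x‖ < ε := by
    have h1 : cfc f a * star x * star (cfc f a * star x) =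
        cfc (fun t => f t * t * f t) a := by
      rw [star_mul, star_star, hfsa, cfc_mul (fun t => f t * t) f a (by fun_prop) (by fun_prop),
        cfc_mul f (fun t => t) a (by fun_prop) (by fun_prop), cfc_id' ℝ a, ha]
      simp only [mul_assoc]
    have h2 : ‖cfc (fun t => f t * t * f t) a‖ ≤ ε ^ 2 / 2 := by
      refine norm_cfc_le (by positivity) fun t _ => ?_
      have h0 := hpos t
      have hf1 : f t ≤ 1 := by
        simp only [f]
        rw [div_le_one h0]
        nlinarith [sq_nonneg t]
      have hf0 : 0 ≤ f t := by positivity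
      have hft : f t * |t| ≤ ε ^ 2 / 2 := by
        simp only [f]
        rw [div_mul_eq_mul_div, div_le_iff₀ h0]
        have := mul_nonneg (sq_nonneg ε) (sq_nonneg (ε ^ 2 - |t|))
        rw [← sq_abs t]
        nlinarith
      rw [Real.norm_eq_abs, abs_mul, abs_mul, abs_of_nonneg hf0]
      nlinarith [mul_nonneg hf0 (abs_nonneg t)]
    have h3 : ‖cfc f a * star x‖ * ‖cfc f a * star x‖ ≤ ε ^ 2 / 2 := by
      rw [← CStarRing.norm_self_mul_star, h1]
      exact h2
    nlinarith [norm_nonneg (cfc f a * star x)]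
  refine ⟨a * cfc g a * star x, ?_, ?_⟩
  · exact J.mul_mem_right _ _ (J.mul_mem_right _ _ haJ)
  · have : star x - a * cfc g a * star x = cfc f a * star x := by
      rw [eq_sub_of_add_eq hsplit]
      noncomm_ring
    rw [dist_eq_norm, this]
    exact hnorm

variable (A) in
/-- A closed (two-sided) ideal of a C⋆-algebra. -/
structure ClosedIdeal where
  /-- The underlying two-sided ideal. -/
  toTwoSidedIdeal : TwoSidedIdeal A
  isClosed : IsClosed (toTwoSidedIdeal : Set A)

namespace ClosedIdeal

instance : Membership A (ClosedIdeal A) := ⟨fun J a => a ∈ J.toTwoSidedIdeal⟩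

/-- A closed ideal, considered as a C⋆-algebra (a closed ⋆-subalgebra of `A`). -/
def toSubalgebra (J : ClosedIdeal A) : NonUnitalStarSubalgebra ℂ A where
  carrier := {a | a ∈ J}
  zero_mem' := J.toTwoSidedIdeal.zero_mem
  add_mem' hx hy := J.toTwoSidedIdeal.add_mem hx hy
  mul_mem' {x _} _ hy := J.toTwoSidedIdeal.mul_mem_left x _ hy
  smul_mem' c x hx := by
    rw [Algebra.smul_def]
    exact J.toTwoSidedIdeal.mul_mem_left _ _ hx
  star_mem' hx := star_mem_of_isClosed J.toTwoSidedIdeal J.isClosed hx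

instance (J : ClosedIdeal A) : IsClosed (J.toSubalgebra : Set A) := J.isClosed

/-- The smallest closed ideal which contains all the ideals `J t`. -/
def generated {T : Type v} (J : T → ClosedIdeal A) : ClosedIdeal A where
  toTwoSidedIdeal := sInf {I : TwoSidedIdeal A | IsClosed (I : Set A) ∧
    ∀ t, (J t).toTwoSidedIdeal ≤ I}
  isClosed := by
    have : ((sInf {I : TwoSidedIdeal A | IsClosed (I : Set A) ∧
        ∀ t, (J t).toTwoSidedIdeal ≤ I} : TwoSidedIdeal A) : Set A) =
        ⋂ I ∈ {I : TwoSidedIdeal A | IsClosed (I : Set A) ∧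
          ∀ t, (J t).toTwoSidedIdeal ≤ I}, (I : Set A) := by
      ext x
      simp only [SetLike.mem_coe, TwoSidedIdeal.mem_sInf, Set.mem_iInter]
    rw [this]
    exact isClosed_biInter fun I hI => hI.1

/-- The coset `a + J` is invertible in the quotient algebra `A / J`. -/
def IsUnitModulo (J : ClosedIdeal A) (a : A) : Prop :=
  IsUnit (a : J.toTwoSidedIdeal.ringCon.Quotient)

end ClosedIdeal

variable {H : Type w} [NormedAddCommGroup H] [InnerProductSpace ℂ H] [CompleteSpace H]

/-- A unital representation `W : A → L(H)` is irreducible if `H` is nonzero and the only closed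
subspaces of `H` that are invariant under all the operators `W a` are `{0}` and `H`. -/
def IsIrreducibleRep (W : A →⋆ₐ[ℂ] (H →L[ℂ] H)) : Prop :=
  Nontrivial H ∧ ∀ V : Submodule ℂ H, IsClosed (V : Set H) →
    (∀ a : A, ∀ x ∈ V, W a x ∈ V) → V = ⊥ ∨ V = ⊤

/-- The representation `W` lifts the closed ideal `J` if its restriction to `J` is injective. -/
def LiftsIdeal (W : A →⋆ₐ[ℂ] (H →L[ℂ] H)) (J : ClosedIdeal A) : Prop :=
  Set.InjOn W {a : A | a ∈ J}

end Ideals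

/-! An elementary ideal is topologically simple, so distinct `J s` and `J t` meet trivially and have
product zero. Since `W s` is irreducible and faithful on `J s`, it kills whatever `J s` annihilates,
in particular `J t`. A minimal projection `p` of `J t`, with `p A p = ℂ p`, goes to a rank one
projection under `W t`. Simplicity then makes `W t` compact on all of `J t`, and cyclicity of
nonzero vectors with closedness of the range gives every compact operator, so `J t ≅ K(H t)`.

Having compact images, or images vanishing at infinity, defines a closed ideal containing every `J
t`, hence also the generated ideal. There the `W t` are jointly injective: if all `W t j` vanish,
then `j` annihilates each `J t`, hence the ideal they generate, hence `star j`, and `j * star j =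
0`. An injective ⋆-homomorphism has closed range, so attaining the finitely supported families is
enough for the isomorphism onto the direct sum.

For invertibility, let `b` invert `a` modulo the ideal. The isomorphism supplies `c` with `W t c =
(W t a)⁻¹ * W t (a * b - 1)`, so `a * c = a * b - 1` and `b - c` is a right inverse
(`exists_mul_eq_one`); adjoints give a left inverse. For the Fredholm statement, `W t b` inverts `W
t a` modulo compact operators. -/

/-! ### Finite rank approximation and Fredholm operators -/

section CompactApproximation

variable {H : Type*} [NormedAddCommGroup H] [InnerProductSpace ℂ H]

/-- A compact operator on a Hilbert space is approximated in norm by its compressions to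
finite-dimensional subspaces of the codomain. -/
theorem IsCompactOperator.exists_norm_sub_starProjection_comp_le {S : H →L[ℂ] H}
    (hS : IsCompactOperator S) {ε : ℝ} (hε : 0 < ε) :
    ∃ (U : Submodule ℂ H) (_ : FiniteDimensional ℂ U), ‖S - U.starProjection ∘L S‖ ≤ ε := by
  have hTB : TotallyBounded (S '' Metric.closedBall (0 : H) 1) :=
    (IsCompactOperator.isCompact_closure_image_closedBall
      (f := (S : H →ₗ[ℂ] H)) hS 1).totallyBounded.subset subset_closure
  obtain ⟨t, ht, hcov⟩ := Metric.totallyBounded_iff.1 hTB ε hε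
  have hfin : FiniteDimensional ℂ (Submodule.span ℂ t) := FiniteDimensional.span_of_finite ℂ ht
  refine ⟨Submodule.span ℂ t, hfin, ContinuousLinearMap.opNorm_le_of_unit_norm hε.le ?_⟩
  intro x hx
  obtain ⟨y, hy, hxy⟩ := Set.mem_iUnion₂.1 (hcov ⟨x, by simp [hx], rfl⟩)
  rw [Metric.mem_ball, dist_eq_norm] at hxy
  have hmin : ‖S x - (Submodule.span ℂ t).starProjection (S x)‖ ≤ ‖S x - y‖ := by
    rw [Submodule.starProjection_minimal]
    exact ciInf_le ⟨0, Set.forall_mem_range.2 fun _ => norm_nonneg _⟩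
      (⟨y, Submodule.subset_span hy⟩ : Submodule.span ℂ t)
  exact hmin.trans hxy.le

variable [CompleteSpace H]

/-- A closed additive subgroup of `L(H)` which contains all operators of rank one contains all
compact operators. -/
theorem IsCompactOperator.mem_of_forall_rankOne_mem {S : H →L[ℂ] H} (hS : IsCompactOperator S)
    (M : AddSubgroup (H →L[ℂ] H)) (hM : IsClosed (M : Set (H →L[ℂ] H)))
    (hrank : ∀ x y : H, InnerProductSpace.rankOne ℂ x y ∈ M) : S ∈ M := by
  change S ∈ (M : Set (H →L[ℂ] H))
  rw [← hM.closure_eq, Metric.mem_closure_iff]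
  intro ε hε
  obtain ⟨U, hU, hle⟩ := hS.exists_norm_sub_starProjection_comp_le (half_pos hε)
  refine ⟨U.starProjection ∘L S, ?_, ?_⟩
  · rw [(stdOrthonormalBasis ℂ U).starProjection_eq_sum_rankOne, ContinuousLinearMap.finsetSum_comp]
    refine AddSubgroup.sum_mem _ fun i _ => ?_
    rw [InnerProductSpace.rankOne_comp]
    exact hrank _ _
  · rw [dist_eq_norm]
    linarith

/-- A compact perturbation of the identity is the sum of an invertible operator and of an operator
of finite rank. -/
theorem IsCompactOperator.exists_isUnit_hasNoetherianRange {S : H →L[ℂ] H}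
    (hS : IsCompactOperator S) : ∃ V : H →L[ℂ] H, IsUnit V ∧
      ((1 + S - V : H →L[ℂ] H) : H →ₗ[ℂ] H).HasNoetherianRange := by
  -- Any bound below 1 would do: `1 + (S - P S)` is then invertible by the Neumann series, and the
  -- remainder `P S` has finite rank.
  obtain ⟨U, hU, hle⟩ := hS.exists_norm_sub_starProjection_comp_le (ε := 1 / 2) (by norm_num)
  refine ⟨1 + (S - U.starProjection ∘L S), ?_, ?_⟩
  · have : ‖-(S - U.starProjection ∘L S)‖ < 1 := by
      rw [norm_neg]
      linarith
    simpa only [sub_neg_eq_add] using isUnit_one_sub_of_norm_lt_one this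
  · have h : ((1 + S - (1 + (S - U.starProjection ∘L S)) : H →L[ℂ] H) : H →ₗ[ℂ] H) =
        U.subtype ∘ₗ (U.orthogonalProjectionOnto ∘L S : H →L[ℂ] U) := by
      ext x
      simp
    rw [h]
    exact (LinearMap.HasNoetherianRange.of_isNoetherian_dom).comp_right _

open LinearMap.FiniteRangeSetoid in
/-- An operator on a Hilbert space which is invertible modulo the compact operators is
Fredholm. -/
theorem ContinuousLinearMap.isFredholm_of_isCompactOperator {a b : H →L[ℂ] H}
    (hab : IsCompactOperator (a * b - 1 : H →L[ℂ] H))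
    (hba : IsCompactOperator (b * a - 1 : H →L[ℂ] H)) : a.IsFredholm := by
  obtain ⟨V, hV, hVr⟩ := hab.exists_isUnit_hasNoetherianRange
  obtain ⟨V', hV', hVr'⟩ := hba.exists_isUnit_hasNoetherianRange
  rw [add_sub_cancel] at hVr hVr'
  obtain ⟨V, rfl⟩ := hV
  obtain ⟨V', rfl⟩ := hV'
  have hr : ((a * (b * (↑V⁻¹ : H →L[ℂ] H)) - 1 : H →L[ℂ] H) : H →ₗ[ℂ] H).HasNoetherianRange := by
    have h := hVr.comp_right ((↑V⁻¹ : H →L[ℂ] H) : H →ₗ[ℂ] H)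
    have h' : ((a * (b * (↑V⁻¹ : H →L[ℂ] H)) - 1 : H →L[ℂ] H)) =
        (a * b - (V : H →L[ℂ] H)) * (↑V⁻¹ : H →L[ℂ] H) := by
      rw [sub_mul, Units.mul_inv, mul_assoc]
    rw [h']
    exact h
  have hl : (((↑V'⁻¹ : H →L[ℂ] H) * b * a - 1 : H →L[ℂ] H) : H →ₗ[ℂ] H).HasNoetherianRange := by
    have h := hVr'.comp_left ((↑V'⁻¹ : H →L[ℂ] H) : H →ₗ[ℂ] H)
    have h' : (((↑V'⁻¹ : H →L[ℂ] H) * b * a - 1 : H →L[ℂ] H)) =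
        (↑V'⁻¹ : H →L[ℂ] H) * (b * a - (V' : H →L[ℂ] H)) := by
      rw [mul_sub, Units.inv_mul, mul_assoc]
    rw [h']
    exact h
  have hr' : (((b * (↑V⁻¹ : H →L[ℂ] H) : H →L[ℂ] H)) : H →ₗ[ℂ] H).IsRightQuasiInverse
      (a : H →ₗ[ℂ] H) := LinearMap.FiniteRangeSetoid.equiv_iff_hasNoetherianRange.2 hr
  have hl' : ((((↑V'⁻¹ : H →L[ℂ] H) * b : H →L[ℂ] H)) : H →ₗ[ℂ] H).IsLeftQuasiInverse
      (a : H →ₗ[ℂ] H) := LinearMap.FiniteRangeSetoid.equiv_iff_hasNoetherianRange.2 hl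
  refine ContinuousLinearMap.IsFredholm.of_isQuasiInverse
    (v := (b * (↑V⁻¹ : H →L[ℂ] H) : H →L[ℂ] H)) ⟨?_, hr'⟩
  set r : H →ₗ[ℂ] H := ↑(b * (↑V⁻¹ : H →L[ℂ] H) : H →L[ℂ] H)
  set l : H →ₗ[ℂ] H := ↑((↑V'⁻¹ : H →L[ℂ] H) * b : H →L[ℂ] H)
  -- A left and a right inverse modulo finite rank agree modulo finite rank, so `r` is two-sided.
  change r ∘ₗ (a : H →ₗ[ℂ] H) ≈ .id
  calc
    r ∘ₗ (a : H →ₗ[ℂ] H) = .id ∘ₗ (r ∘ₗ (a : H →ₗ[ℂ] H)) := rfl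
    _ ≈ (l ∘ₗ (a : H →ₗ[ℂ] H)) ∘ₗ (r ∘ₗ (a : H →ₗ[ℂ] H)) := by grw [hl'.equiv]
    _ = l ∘ₗ ((a : H →ₗ[ℂ] H) ∘ₗ r) ∘ₗ (a : H →ₗ[ℂ] H) := rfl
    _ ≈ l ∘ₗ .id ∘ₗ (a : H →ₗ[ℂ] H) := by grw [hr'.equiv]
    _ ≈ .id := hl'.equiv

end CompactApproximation

/-! ### Isomorphisms onto direct sums -/

section DirectSum

/-- A jointly injective family of ⋆-homomorphisms whose norms vanish at infinity and which attains
all families supported at a single index is an isomorphism onto the direct sum. -/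
theorem exists_starAlgEquiv_directSumCStar {B : Type*} [NonUnitalCStarAlgebra B] {I : Type*}
    {K : I → Type*} [∀ i, NonUnitalCStarAlgebra (K i)] (ρ : ∀ i, B →⋆ₙₐ[ℂ] K i)
    (hinj : ∀ b, (∀ i, ρ i b = 0) → b = 0)
    (hfin : ∀ b, ∀ ε : ℝ, 0 < ε → {i | ε ≤ ‖ρ i b‖}.Finite)
    (hsurj : ∀ i (k : K i), ∃ b, ρ i b = k ∧ ∀ i' ≠ i, ρ i' b = 0) :
    ∃ Φ : B ≃⋆ₐ[ℂ] directSumCStar K, ∀ b i, (Φ b : lp K ∞) i = ρ i b := by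
  classical
  have hmem : ∀ b, Memℓp (fun i => ρ i b) ∞ := fun b => memℓp_infty
    ⟨‖b‖, Set.forall_mem_range.2 fun i => NonUnitalStarAlgHom.norm_apply_le (ρ i) b⟩
  let Ψ : B →⋆ₙₐ[ℂ] lp K ∞ :=
    { toFun b := ⟨fun i => ρ i b, hmem b⟩
      map_smul' c b := by ext i; exact map_smul (ρ i) c b
      map_zero' := by ext i; exact map_zero (ρ i)
      map_add' a b := by ext i; exact map_add (ρ i) a b
      map_mul' a b := by ext i; exact map_mul (ρ i) a b
      map_star' a := by ext i; exact map_star (ρ i) a }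
  have hΨ : ∀ b i, (Ψ b : lp K ∞) i = ρ i b := fun _ _ => rfl
  have hΨinj : Function.Injective Ψ := (injective_iff_map_eq_zero Ψ).2 fun b hb =>
    hinj b fun i => by rw [← hΨ, hb]; rfl
  have hΨmem : ∀ b, Ψ b ∈ directSumCStar K := fun b => hfin b
  have hclosed : IsClosed (Set.range Ψ) :=
    (NonUnitalStarAlgHom.isometry Ψ hΨinj).isClosedEmbedding.isClosed_range
  have hrange : ∀ x ∈ directSumCStar K, x ∈ Set.range Ψ := by
    intro x hx
    rw [← hclosed.closure_eq, Metric.mem_closure_iff]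
    intro ε hε
    -- The finitely many coordinates of norm at least `ε / 2` are matched exactly by a sum of the `b
    -- i`; the others contribute less than `ε / 2` to the supremum norm.
    choose b hb hb' using fun i => hsurj i (x i)
    have hF := hx (ε / 2) (half_pos hε)
    refine ⟨Ψ (∑ i ∈ hF.toFinset, b i), ⟨_, rfl⟩, ?_⟩
    rw [dist_eq_norm]
    refine (lp.norm_le_of_forall_le (half_pos hε).le fun i => ?_).trans_lt (half_lt_self hε)
    have hval : (x - Ψ (∑ i ∈ hF.toFinset, b i) : lp K ∞) i =
        x i - if i ∈ hF.toFinset then x i else 0 := by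
      rw [lp.coeFn_sub, Pi.sub_apply, hΨ, map_sum]
      congr 1
      split_ifs with hi
      · rw [Finset.sum_eq_single_of_mem i hi fun j _ hj => hb' j i hj.symm, hb]
      · exact Finset.sum_eq_zero fun j hj => hb' j i fun h => hi (h ▸ hj)
    rw [hval]
    split_ifs with hi
    · simpa using (half_pos hε).le
    · simp only [Set.Finite.mem_toFinset, Set.mem_ofPred_eq, not_le] at hi
      simpa using hi.le
  let Φ := NonUnitalStarAlgHom.codRestrict Ψ (directSumCStar K) hΨmem
  have hΦ : Function.Bijective Φ := by
    refine ⟨fun a b hab => hΨinj (congrArg Subtype.val hab), fun x => ?_⟩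
    obtain ⟨b, hb⟩ := hrange x x.2
    exact ⟨b, Subtype.ext hb⟩
  exact ⟨StarAlgEquiv.ofBijective Φ hΦ, fun b i => hΨ b i⟩

/-- The variant of `exists_starAlgEquiv_directSumCStar` in which the summands are only given up to
isomorphism. -/
theorem nonempty_starAlgEquiv_directSumCStar {B : Type*} [NonUnitalCStarAlgebra B] {I : Type*}
    {K C : I → Type*} [∀ i, NonUnitalCStarAlgebra (K i)] [∀ i, NonUnitalCStarAlgebra (C i)]
    (e : ∀ i, K i ≃⋆ₐ[ℂ] C i) (π : ∀ i, B →⋆ₙₐ[ℂ] C i)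
    (hinj : ∀ b, (∀ i, π i b = 0) → b = 0)
    (hfin : ∀ b, ∀ ε : ℝ, 0 < ε → {i | ε ≤ ‖π i b‖}.Finite)
    (hsurj : ∀ i (k : C i), ∃ b, π i b = k ∧ ∀ i' ≠ i, π i' b = 0) :
    Nonempty (B ≃⋆ₐ[ℂ] directSumCStar K) := by
  let ρ : ∀ i, B →⋆ₙₐ[ℂ] K i := fun i => ((e i).symm : C i →⋆ₙₐ[ℂ] K i).comp (π i)
  have hρ : ∀ i b, ρ i b = (e i).symm (π i b) := fun _ _ => rfl
  have hρ0 : ∀ i b, ρ i b = 0 ↔ π i b = 0 := fun i b => by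
    rw [hρ, EmbeddingLike.map_eq_zero_iff]
  obtain ⟨Φ, -⟩ := exists_starAlgEquiv_directSumCStar ρ
    (fun b hb => hinj b fun i => (hρ0 i b).1 (hb i))
    (fun b ε hε => by simpa only [hρ, StarAlgEquiv.norm_map] using hfin b ε hε)
    (fun i k => by
      obtain ⟨b, hb, hb'⟩ := hsurj i (e i k)
      exact ⟨b, by rw [hρ, hb, StarAlgEquiv.symm_apply_apply],
        fun i' hi' => (hρ0 i' b).2 (hb' i' hi')⟩)
  exact ⟨Φ⟩

end DirectSum

/-! ### Simplicity and minimal projections of elementary ideals -/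

section Elementary

theorem InnerProductSpace.isCompactOperator_rankOne {H : Type*} [NormedAddCommGroup H]
    [InnerProductSpace ℂ H] (x y : H) :
    IsCompactOperator (InnerProductSpace.rankOne ℂ x y : H →L[ℂ] H) := by
  rw [InnerProductSpace.rankOne_def']
  have h : IsCompactOperator (ContinuousLinearMap.toSpanSingleton ℂ x) :=
    isCompactOperator_of_locallyCompactSpace_rng _
  exact h.comp_clm _

/-- The algebra of the compact operators on a Hilbert space is topologically simple. -/
theorem IsCompactOperator.mem_of_ne_zero {H : Type*} [NormedAddCommGroup H]
    [InnerProductSpace ℂ H] [CompleteSpace H] (M : AddSubgroup (H →L[ℂ] H))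
    (hM : IsClosed (M : Set (H →L[ℂ] H)))
    (hmul : ∀ S ∈ M, ∀ R₁ R₂ : H →L[ℂ] H, IsCompactOperator R₁ → IsCompactOperator R₂ →
      R₁ * S * R₂ ∈ M) {S : H →L[ℂ] H} (hSM : S ∈ M) (hS : S ≠ 0) {R : H →L[ℂ] H}
    (hR : IsCompactOperator R) : R ∈ M := by
  obtain ⟨v, hv⟩ : ∃ v, S v ≠ 0 := by
    by_contra! h
    exact hS (ContinuousLinearMap.ext h)
  refine hR.mem_of_forall_rankOne_mem M hM fun y z => ?_
  have hne : inner ℂ (S v) (S v) ≠ 0 := inner_self_ne_zero.2 hv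
  -- Sandwiching `S` between rank one operators through `v` and `S v` leaves the scalar `⟪S v, S
  -- v⟫`, which the inverse factor cancels.
  have h := hmul S hSM _ _
    (InnerProductSpace.isCompactOperator_rankOne ((inner ℂ (S v) (S v))⁻¹ • y) (S v))
    (InnerProductSpace.isCompactOperator_rankOne v z)
  convert h using 1
  ext w
  rw [mul_apply_eq_comp, mul_apply_eq_comp, InnerProductSpace.rankOne_apply,
    InnerProductSpace.rankOne_apply, InnerProductSpace.rankOne_apply, map_smul, inner_smul_right,
    smul_smul, mul_assoc, mul_inv_cancel₀ hne, mul_one]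

variable {A : Type u} [CStarAlgebra A]

/-- A closed ideal which meets an elementary ideal nontrivially contains it. -/
theorem IsElementary.mem_of_mem {J : ClosedIdeal A} (hJ : IsElementary J.toSubalgebra)
    (I : TwoSidedIdeal A) (hI : IsClosed (I : Set A)) {x : A} (hxJ : x ∈ J) (hxI : x ∈ I)
    (hx : x ≠ 0) {y : A} (hy : y ∈ J) : y ∈ I := by
  obtain ⟨H, _, _, _, -, ⟨e⟩⟩ := hJ
  have he : Continuous fun k => (e.symm k : A) :=
    continuous_subtype_val.comp (StarAlgEquiv.isometry e.symm).continuous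
  -- The image of `I ∩ J` in `K(H)`, viewed inside `L(H)`.
  let M : AddSubgroup (H →L[ℂ] H) :=
    { carrier := Subtype.val '' {k : compactOperators H | (e.symm k : A) ∈ I}
      zero_mem' := ⟨0, by simp, rfl⟩
      add_mem' := by
        rintro _ _ ⟨a, ha, rfl⟩ ⟨b, hb, rfl⟩
        refine ⟨a + b, ?_, rfl⟩
        rw [Set.mem_ofPred_eq, map_add]
        exact I.add_mem ha hb
      neg_mem' := by
        rintro _ ⟨a, ha, rfl⟩
        refine ⟨-a, ?_, rfl⟩
        rw [Set.mem_ofPred_eq, map_neg]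
        exact I.neg_mem ha }
  have hM : IsClosed (M : Set (H →L[ℂ] H)) :=
    (compactOperators_isClosed (H := H)).isClosedEmbedding_subtypeVal.isClosedMap _
      (hI.preimage he)
  have hmul : ∀ S ∈ M, ∀ R₁ R₂ : H →L[ℂ] H, IsCompactOperator R₁ → IsCompactOperator R₂ →
      R₁ * S * R₂ ∈ M := by
    rintro _ ⟨k, hk, rfl⟩ R₁ R₂ h₁ h₂
    let k₁ : compactOperators H := ⟨R₁, h₁⟩
    let k₂ : compactOperators H := ⟨R₂, h₂⟩
    refine ⟨k₁ * k * k₂, ?_, rfl⟩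
    rw [Set.mem_ofPred_eq, map_mul, map_mul]
    exact I.mul_mem_right _ _ (I.mul_mem_left _ _ hk)
  have hmem : ∀ z : J.toSubalgebra, (e z : H →L[ℂ] H) ∈ M ↔ (z : A) ∈ I := by
    refine fun z => ⟨?_, fun hz => ⟨e z, ?_, rfl⟩⟩
    · rintro ⟨k, hk, hkz⟩
      rwa [Subtype.ext hkz, Set.mem_ofPred_eq, StarAlgEquiv.symm_apply_apply] at hk
    · rwa [Set.mem_ofPred_eq, StarAlgEquiv.symm_apply_apply]
  have he0 : (e ⟨x, hxJ⟩ : H →L[ℂ] H) ≠ 0 := by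
    intro h
    have h0 : e ⟨x, hxJ⟩ = 0 := Subtype.ext h
    rw [EmbeddingLike.map_eq_zero_iff] at h0
    exact hx (congrArg Subtype.val h0)
  exact (hmem ⟨y, hy⟩).1 (IsCompactOperator.mem_of_ne_zero M hM hmul ((hmem ⟨x, hxJ⟩).2 hxI) he0
    (e ⟨y, hy⟩).2)

/-- An elementary ideal contains a minimal projection. -/
theorem IsElementary.exists_minimal_projection {J : ClosedIdeal A}
    (hJ : IsElementary J.toSubalgebra) :
    ∃ p ∈ J, p ≠ 0 ∧ IsStarProjection p ∧ ∀ a : A, ∃ c : ℂ, p * a * p = c • p := by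
  obtain ⟨H, _, _, _, _, ⟨e⟩⟩ := hJ
  obtain ⟨x, hx⟩ := exists_norm_eq H zero_le_one
  let R : compactOperators H :=
    ⟨InnerProductSpace.rankOne ℂ x x, InnerProductSpace.isCompactOperator_rankOne _ _⟩
  have hR0 : R ≠ 0 := by
    intro h
    have h' : InnerProductSpace.rankOne ℂ x x = 0 := congrArg Subtype.val h
    rw [InnerProductSpace.rankOne_eq_zero, or_self] at h'
    simp [h'] at hx
  have hRR : IsStarProjection R :=
    ⟨Subtype.ext (InnerProductSpace.isStarProjection_rankOne_self (𝕜 := ℂ) hx).1,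
      Subtype.ext (InnerProductSpace.isStarProjection_rankOne_self (𝕜 := ℂ) hx).2⟩
  have hp : IsStarProjection (e.symm R : A) :=
    ⟨show _ = _ from congrArg Subtype.val (hRR.map e.symm).1.eq,
      show _ = _ from congrArg Subtype.val (hRR.map e.symm).2.star_eq⟩
  refine ⟨e.symm R, (e.symm R).2, ?_, hp, fun a => ?_⟩
  · intro h
    have : e.symm R = 0 := Subtype.ext h
    rw [EmbeddingLike.map_eq_zero_iff] at this
    exact hR0 this
  -- `e` is defined only on `J`, so `a` is replaced by `p * a`; this does not change `p * a * p`.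
  · let b : J.toSubalgebra :=
      ⟨e.symm R * a, J.toTwoSidedIdeal.mul_mem_right _ _ (e.symm R).2⟩
    refine ⟨inner ℂ x ((e b : H →L[ℂ] H) x), ?_⟩
    have h1 : R * e b * R = (inner ℂ x ((e b : H →L[ℂ] H) x) : ℂ) • R := by
      ext w
      change InnerProductSpace.rankOne ℂ x x ((e b : H →L[ℂ] H) (InnerProductSpace.rankOne ℂ x x w))
        = (inner ℂ x ((e b : H →L[ℂ] H) x) : ℂ) • InnerProductSpace.rankOne ℂ x x w
      simp only [InnerProductSpace.rankOne_apply, map_smul, smul_smul]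
      rw [mul_comm]
    have h2 := congrArg (fun k => (e.symm k : A)) h1
    simp only [map_mul, map_smul, StarAlgEquiv.symm_apply_apply] at h2
    have h3 : (e.symm R : A) * a * e.symm R = e.symm R * (e.symm R * a) * e.symm R := by
      rw [← mul_assoc, hp.1.eq]
    rw [h3]
    exact h2

end Elementary

/-! ### Irreducible representations lifting an elementary ideal -/

section Irreducible

variable {A : Type u} [CStarAlgebra A]
variable {H : Type w} [NormedAddCommGroup H] [InnerProductSpace ℂ H] [CompleteSpace H]

/-- Every nonzero vector is cyclic for an irreducible representation. -/
theorem IsIrreducibleRep.denseRange_apply {W : A →⋆ₐ[ℂ] (H →L[ℂ] H)} (hW : IsIrreducibleRep W)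
    {x : H} (hx : x ≠ 0) : DenseRange fun a => W a x := by
  let L : A →ₗ[ℂ] H :=
    { toFun a := W a x
      map_add' a b := by simp
      map_smul' c a := by simp }
  let V := (LinearMap.range L).topologicalClosure
  have hVinv : ∀ a : A, ∀ y ∈ V, W a y ∈ V := by
    intro a y hy
    refine map_mem_closure (W a).continuous hy ?_
    rintro _ ⟨b, rfl⟩
    exact ⟨a * b, by simp [L]⟩
  rcases hW.2 V (LinearMap.range L).isClosed_topologicalClosure hVinv with h | h
  · have : x ∈ V := (LinearMap.range L).le_topologicalClosure ⟨1, by simp [L]⟩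
    rw [h, Submodule.mem_bot] at this
    exact absurd this hx
  · intro y
    have : y ∈ V := h ▸ Submodule.mem_top
    exact this

/-- An irreducible representation which is injective on a nonzero ideal annihilates every ideal
orthogonal to it. -/
theorem IsIrreducibleRep.eq_zero_of_forall_mul_eq_zero {W : A →⋆ₐ[ℂ] (H →L[ℂ] H)}
    (hW : IsIrreducibleRep W) {J : ClosedIdeal A} (hWJ : LiftsIdeal W J) {p : A} (hpJ : p ∈ J)
    (hp : p ≠ 0) {b : A} (hb : ∀ c ∈ J, c * b = 0) : W b = 0 := by
  by_contra h
  obtain ⟨y, hy⟩ : ∃ y, W b y ≠ 0 := by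
    by_contra! h'
    exact h (ContinuousLinearMap.ext h')
  refine hp (hWJ hpJ J.toTwoSidedIdeal.zero_mem ?_)
  rw [map_zero]
  -- The vectors `W a (W b y)` are dense, and `W p` kills each because `p * a` lies in `J`.
  refine ContinuousLinearMap.coeFn_injective ((hW.denseRange_apply hy).equalizer
    (W p).continuous continuous_const (funext fun a => ?_))
  have h1 : p * a * b = 0 := hb _ (J.toTwoSidedIdeal.mul_mem_right _ _ hpJ)
  have h2 := congrArg (fun T => T y) (congrArg W h1)
  simpa [mul_assoc] using h2

/-- An irreducible representation maps the minimal projections that it does not annihilate to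
projections of rank one. -/
theorem IsIrreducibleRep.exists_map_eq_rankOne {W : A →⋆ₐ[ℂ] (H →L[ℂ] H)}
    (hW : IsIrreducibleRep W) {p : A} (hp : IsStarProjection p)
    (hmin : ∀ a : A, ∃ c : ℂ, p * a * p = c • p) (hWp : W p ≠ 0) :
    ∃ x : H, x ≠ 0 ∧ W p = InnerProductSpace.rankOne ℂ x x := by
  obtain ⟨z, hz⟩ : ∃ z, W p z ≠ 0 := by
    by_contra! h'
    exact hWp (ContinuousLinearMap.ext h')
  have hP : IsStarProjection (W p) := hp.map W
  have hfix : ∀ y, W p (W p y) = W p y := fun y => congrArg (fun T => T y) hP.1.eq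
  set x : H := ((‖W p z‖ : ℂ)⁻¹) • W p z with hxdef
  have hxn : ‖x‖ = 1 := by
    rw [hxdef, norm_smul, norm_inv, Complex.norm_real, norm_norm,
      inv_mul_cancel₀ (norm_ne_zero_iff.2 hz)]
  have hx0 : x ≠ 0 := norm_ne_zero_iff.1 (hxn ▸ one_ne_zero)
  have hPx : W p x = x := by rw [hxdef, map_smul, hfix]
  -- On the dense set of vectors `W a x`, minimality gives `W p (W a x) = W (p * a * p) x = c • x`.
  have hmem : ∀ y, W p y ∈ Submodule.span ℂ {x} := by
    have hcl : IsClosed {y | W p y ∈ Submodule.span ℂ {x}} :=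
      (Submodule.closed_of_finiteDimensional _).preimage (W p).continuous
    refine fun y => (hW.denseRange_apply hx0).induction_on y hcl fun a => ?_
    obtain ⟨c, hc⟩ := hmin a
    have h1 : W p (W a x) = c • x := by
      have h2 := congrArg (fun T => T x) (congrArg W hc)
      simpa [hPx] using h2
    change W p (W a x) ∈ _
    rw [h1]
    exact Submodule.smul_mem _ _ (Submodule.mem_span_singleton_self x)
  refine ⟨x, hx0, ContinuousLinearMap.ext fun y => ?_⟩
  obtain ⟨c, hc⟩ := Submodule.mem_span_singleton.1 (hmem y)
  have h1 : inner ℂ x (W p y) = inner ℂ x y := by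
    have h3 : ContinuousLinearMap.adjoint (W p) = W p := hP.2
    rw [← ContinuousLinearMap.adjoint_inner_left, h3, hPx]
  rw [← hc, inner_smul_right, inner_self_eq_norm_sq_to_K, hxn] at h1
  rw [InnerProductSpace.rankOne_apply, ← h1, ← hc]
  simp

variable {W : A →⋆ₐ[ℂ] (H →L[ℂ] H)} {J : ClosedIdeal A}

theorem StarAlgHom.continuous_of_cstar (W : A →⋆ₐ[ℂ] (H →L[ℂ] H)) : Continuous W :=
  (NonUnitalStarAlgHom.instContinuousLinearMapClassComplex
    (F := A →⋆ₐ[ℂ] (H →L[ℂ] H))).map_continuous W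

/-- The closed ideal of the elements with compact image under a representation. -/
def StarAlgHom.compactPreimage (W : A →⋆ₐ[ℂ] (H →L[ℂ] H)) : ClosedIdeal A where
  toTwoSidedIdeal := TwoSidedIdeal.mk' {a | IsCompactOperator (W a)}
    (by simpa using isCompactOperator_zero)
    (fun {a b} ha hb => by simpa using IsCompactOperator.add ha hb)
    (fun {a} ha => by simpa using IsCompactOperator.neg ha)
    (fun {a b} hb => by simpa using IsCompactOperator.clm_comp hb (W a))
    (fun {a b} ha => by simpa using IsCompactOperator.comp_clm ha (W b))
  isClosed := by
    rw [TwoSidedIdeal.coe_mk']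
    exact isClosed_setOfPred_isCompactOperator.preimage
      (StarAlgHom.continuous_of_cstar W)

theorem StarAlgHom.mem_compactPreimage {a : A} :
    a ∈ W.compactPreimage.toTwoSidedIdeal ↔ IsCompactOperator (W a) :=
  by simp only [StarAlgHom.compactPreimage, TwoSidedIdeal.mem_mk', Set.mem_ofPred_eq]

/-- `W.compactPreimage` is a closed ideal that contains a minimal projection of `J`, whose image has
rank one; by simplicity it contains `J`. -/
theorem IsIrreducibleRep.isCompactOperator_map (hW : IsIrreducibleRep W)
    (hJ : IsElementary J.toSubalgebra) (hWJ : LiftsIdeal W J) {a : A} (ha : a ∈ J) :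
    IsCompactOperator (W a) := by
  obtain ⟨p, hpJ, hp0, hp, hmin⟩ := hJ.exists_minimal_projection
  have hWp : W p ≠ 0 := fun h =>
    hp0 (hWJ hpJ J.toTwoSidedIdeal.zero_mem (h.trans (map_zero W).symm))
  obtain ⟨x, -, hx⟩ := hW.exists_map_eq_rankOne hp hmin hWp
  refine StarAlgHom.mem_compactPreimage.1
    (hJ.mem_of_mem _ W.compactPreimage.isClosed hpJ ?_ hp0 ha)
  rw [StarAlgHom.mem_compactPreimage, hx]
  exact InnerProductSpace.isCompactOperator_rankOne x x

/-- The image of `J` is closed, since `W` is isometric there. If `W p` is the rank one operator of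
`x`, the image contains `W (a * p * star b)`, the rank one operator of the pair `W a x`, `W b x`;
such pairs are dense by cyclicity. -/
theorem IsIrreducibleRep.exists_map_eq (hW : IsIrreducibleRep W)
    (hJ : IsElementary J.toSubalgebra) (hWJ : LiftsIdeal W J) {S : H →L[ℂ] H}
    (hS : IsCompactOperator S) : ∃ a ∈ J, W a = S := by
  obtain ⟨p, hpJ, hp0, hp, hmin⟩ := hJ.exists_minimal_projection
  have hWp : W p ≠ 0 := fun h =>
    hp0 (hWJ hpJ J.toTwoSidedIdeal.zero_mem (h.trans (map_zero W).symm))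
  obtain ⟨x, hx0, hx⟩ := hW.exists_map_eq_rankOne hp hmin hWp
  let ψ : J.toSubalgebra →⋆ₙₐ[ℂ] (H →L[ℂ] H) :=
    (W : A →⋆ₙₐ[ℂ] (H →L[ℂ] H)).comp (NonUnitalStarSubalgebraClass.subtype J.toSubalgebra)
  have hψ : ∀ a, ψ a = W a := fun _ => rfl
  have hψinj : Function.Injective ψ := fun a b hab => Subtype.ext (hWJ a.2 b.2 hab)
  let M : AddSubgroup (H →L[ℂ] H) := AddMonoidHom.range (ψ : J.toSubalgebra →+ (H →L[ℂ] H))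
  have hM : IsClosed (M : Set (H →L[ℂ] H)) :=
    (NonUnitalStarAlgHom.isometry ψ hψinj).isClosedEmbedding.isClosed_range
  have hrank : ∀ y z : H, InnerProductSpace.rankOne ℂ y z ∈ M := by
    have hd := hW.denseRange_apply hx0
    have hc : Continuous fun q : H × H => (InnerProductSpace.rankOne ℂ q.1 q.2 : H →L[ℂ] H) :=
      (ContinuousLinearMap.smulRightL ℂ H H).continuous₂.comp
        (((innerSL ℂ).continuous.comp continuous_snd).prodMk continuous_fst)
    intro y z
    refine hd.induction_on₂ (p := fun y z => InnerProductSpace.rankOne ℂ y z ∈ M)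
      (hM.preimage hc)
      (fun a b => ?_) y z
    refine ⟨⟨a * p * star b,
      J.toTwoSidedIdeal.mul_mem_right _ _ (J.toTwoSidedIdeal.mul_mem_left _ _ hpJ)⟩, ?_⟩
    change W (a * p * star b) = _
    rw [map_mul, map_mul, map_star, hx, ContinuousLinearMap.star_eq_adjoint]
    ext w
    simp [InnerProductSpace.rankOne_apply, ContinuousLinearMap.adjoint_inner_right]
  obtain ⟨a, ha⟩ := hS.mem_of_forall_rankOne_mem M hM hrank
  exact ⟨a, a.2, ha⟩

end Irreducible

/-! ### The generated closed ideal and its quotient -/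

section Generated

namespace ClosedIdeal

variable {A : Type u} [CStarAlgebra A] {T : Type v} {J : T → ClosedIdeal A}

@[ext]
theorem ext {I I' : ClosedIdeal A} (h : ∀ a, a ∈ I ↔ a ∈ I') : I = I' := by
  cases I
  cases I'
  congr
  exact TwoSidedIdeal.ext h

theorem mem_generated_of_mem {t : T} {a : A} (ha : a ∈ J t) : a ∈ generated J :=
  (TwoSidedIdeal.mem_sInf A).2 fun _ hI => hI.2 t ha

theorem mem_of_mem_generated {I : TwoSidedIdeal A} (hI : IsClosed (I : Set A))
    (hJI : ∀ t, ∀ a ∈ J t, a ∈ I) {a : A} (ha : a ∈ generated J) : a ∈ I :=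
  (TwoSidedIdeal.mem_sInf A).1 ha I ⟨hI, fun t _ hx => hJI t _ hx⟩

/-- An element of the closed ideal generated by a family which annihilates every member of the
family from the left is zero. -/
theorem eq_zero_of_forall_mul_eq_zero {j : A} (hj : j ∈ generated J)
    (h : ∀ t, ∀ a ∈ J t, j * a = 0) : j = 0 := by
  -- The right annihilator of `j` alone is only a right ideal; the factor `b` makes it two-sided.
  let N : TwoSidedIdeal A := TwoSidedIdeal.mk' {a | ∀ b, j * b * a = 0}
    (fun b => mul_zero _)
    (fun {x y} hx hy b => by rw [mul_add, hx, hy, add_zero])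
    (fun {x} hx b => by rw [mul_neg, hx, neg_zero])
    (fun {x y} hy b => by rw [← mul_assoc, mul_assoc j, hy])
    (fun {x y} hx b => by rw [← mul_assoc, hx, zero_mul])
  have hN : (N : Set A) = {a | ∀ b, j * b * a = 0} := TwoSidedIdeal.coe_mk' ..
  have hNc : IsClosed (N : Set A) := by
    rw [hN, Set.ofPred_forall]
    exact isClosed_iInter fun b => isClosed_eq (by fun_prop) continuous_const
  have hJN : ∀ t, ∀ a ∈ J t, a ∈ N := by
    intro t a ha
    change a ∈ (N : Set A)
    rw [hN]
    intro b
    rw [mul_assoc]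
    exact h t _ ((J t).toTwoSidedIdeal.mul_mem_left _ _ ha)
  have hmem : star j ∈ (N : Set A) := mem_of_mem_generated hNc hJN
    (star_mem_of_isClosed _ (generated J).isClosed hj)
  rw [hN] at hmem
  have h1 := hmem 1
  rw [mul_one] at h1
  exact CStarRing.mul_star_self_eq_zero_iff j |>.1 h1

theorem isUnitModulo_iff {I : ClosedIdeal A} {a : A} :
    I.IsUnitModulo a ↔ ∃ b, a * b - 1 ∈ I ∧ b * a - 1 ∈ I := by
  have hrel : ∀ x y : A, (x : I.toTwoSidedIdeal.ringCon.Quotient) = y ↔ x - y ∈ I := fun x y => by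
    rw [RingCon.eq, TwoSidedIdeal.rel_iff]
    rfl
  constructor
  · rintro ⟨u, hu⟩
    obtain ⟨b, hb⟩ := RingCon.mk'_surjective _ (↑u⁻¹ : I.toTwoSidedIdeal.ringCon.Quotient)
    have hb' : (b : I.toTwoSidedIdeal.ringCon.Quotient) = ↑u⁻¹ := hb
    refine ⟨b, (hrel _ _).1 ?_, (hrel _ _).1 ?_⟩
    · rw [RingCon.coe_mul, hb', ← hu, Units.mul_inv, RingCon.coe_one]
    · rw [RingCon.coe_mul, hb', ← hu, Units.inv_mul, RingCon.coe_one]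
  · rintro ⟨b, hab, hba⟩
    refine ⟨⟨a, b, ?_, ?_⟩, rfl⟩
    · rw [← RingCon.coe_mul, ← RingCon.coe_one, hrel]
      exact hab
    · rw [← RingCon.coe_mul, ← RingCon.coe_one, hrel]
      exact hba

end ClosedIdeal

end Generated

/-! ### Orthogonality, joint injectivity and decay at infinity -/

section Family

variable {A : Type u} [CStarAlgebra A] {T : Type v} {J : T → ClosedIdeal A}

/-- The product lies in both ideals; were it nonzero, simplicity would make each contain the other.
-/
theorem IsElementary.mul_eq_zero_of_ne {J₁ J₂ : ClosedIdeal A}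
    (h₁ : IsElementary J₁.toSubalgebra) (h₂ : IsElementary J₂.toSubalgebra) (hne : J₁ ≠ J₂)
    {a b : A} (ha : a ∈ J₁) (hb : b ∈ J₂) : a * b = 0 := by
  by_contra h
  have hm₁ : a * b ∈ J₁ := J₁.toTwoSidedIdeal.mul_mem_right _ _ ha
  have hm₂ : a * b ∈ J₂ := J₂.toTwoSidedIdeal.mul_mem_left _ _ hb
  exact hne (ClosedIdeal.ext fun x =>
    ⟨fun hx => h₁.mem_of_mem J₂.toTwoSidedIdeal J₂.isClosed hm₁ hm₂ h hx,
      fun hx => h₂.mem_of_mem J₁.toTwoSidedIdeal J₁.isClosed hm₂ hm₁ h hx⟩)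

variable {H : T → Type w} [∀ t, NormedAddCommGroup (H t)] [∀ t, InnerProductSpace ℂ (H t)]
  [∀ t, CompleteSpace (H t)] {W : ∀ t, A →⋆ₐ[ℂ] (H t →L[ℂ] H t)}

theorem map_eq_zero_of_ne (hJ : ∀ t, IsElementary (J t).toSubalgebra)
    (hJne : ∀ s t, s ≠ t → J s ≠ J t) (hWirr : ∀ t, IsIrreducibleRep (W t))
    (hWlift : ∀ t, LiftsIdeal (W t) (J t)) {s t : T} (hst : s ≠ t) {a : A} (ha : a ∈ J t) :
    W s a = 0 := by
  obtain ⟨p, hpJ, hp0, -⟩ := (hJ s).exists_minimal_projection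
  exact (hWirr s).eq_zero_of_forall_mul_eq_zero (hWlift s) hpJ hp0 fun c hc =>
    (hJ s).mul_eq_zero_of_ne (hJ t) (hJne s t hst) hc ha

/-- For `a` in `J t`, the product `j * a` lies in `J t` and is killed by `W t`, so it vanishes.
Hence `j` annihilates every `J t`. -/
theorem eq_zero_of_forall_map_eq_zero (hWlift : ∀ t, LiftsIdeal (W t) (J t)) {j : A}
    (hj : j ∈ ClosedIdeal.generated J) (h : ∀ t, W t j = 0) : j = 0 :=
  ClosedIdeal.eq_zero_of_forall_mul_eq_zero hj fun t a ha =>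
    hWlift t ((J t).toTwoSidedIdeal.mul_mem_left _ _ ha) (J t).toTwoSidedIdeal.zero_mem (by
      rw [map_mul, h, zero_mul, map_zero])

theorem isCompactOperator_map_of_mem_generated (hJ : ∀ t, IsElementary (J t).toSubalgebra)
    (hJne : ∀ s t, s ≠ t → J s ≠ J t) (hWirr : ∀ t, IsIrreducibleRep (W t))
    (hWlift : ∀ t, LiftsIdeal (W t) (J t)) {j : A} (hj : j ∈ ClosedIdeal.generated J) (t : T) :
    IsCompactOperator (W t j) := by
  refine StarAlgHom.mem_compactPreimage.1 (ClosedIdeal.mem_of_mem_generated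
    (W t).compactPreimage.isClosed (fun s a ha => StarAlgHom.mem_compactPreimage.2 ?_) hj)
  obtain rfl | hst := eq_or_ne t s
  · exact (hWirr t).isCompactOperator_map (hJ t) (hWlift t) ha
  · rw [map_eq_zero_of_ne hJ hJne hWirr hWlift hst ha]
    exact isCompactOperator_zero

/-- The ideal of the elements whose images under the representations `W t` vanish at infinity. -/
def vanishingAtInfinity (W : ∀ t, A →⋆ₐ[ℂ] (H t →L[ℂ] H t)) : TwoSidedIdeal A :=
  TwoSidedIdeal.mk' {a | ∀ ε : ℝ, 0 < ε → {t | ε ≤ ‖W t a‖}.Finite}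
    (fun ε hε => Set.finite_empty.subset fun t ht => by
      rw [Set.mem_ofPred_eq, map_zero, norm_zero] at ht
      exact absurd ht hε.not_ge)
    (fun {a b} ha hb ε hε => ((ha _ (half_pos hε)).union (hb _ (half_pos hε))).subset fun t ht => by
      by_contra h
      simp only [Set.mem_union, Set.mem_ofPred_eq, not_or, not_le, map_add] at h ht
      linarith [norm_add_le (W t a) (W t b)])
    (fun {a} ha ε hε => by simpa only [map_neg, norm_neg] using ha ε hε)
    (fun {a b} hb ε hε => (hb (ε / (‖a‖ + 1)) (by positivity)).subset fun t ht => by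
      simp only [Set.mem_ofPred_eq, map_mul] at ht ⊢
      rw [div_le_iff₀ (by positivity)]
      nlinarith [norm_mul_le (W t a) (W t b), norm_nonneg (W t b),
        mul_le_mul_of_nonneg_right (NonUnitalStarAlgHom.norm_apply_le (W t) a)
          (norm_nonneg (W t b))])
    (fun {a b} ha ε hε => (ha (ε / (‖b‖ + 1)) (by positivity)).subset fun t ht => by
      simp only [Set.mem_ofPred_eq, map_mul] at ht ⊢
      rw [div_le_iff₀ (by positivity)]
      nlinarith [norm_mul_le (W t a) (W t b), norm_nonneg (W t a),
        mul_le_mul_of_nonneg_left (NonUnitalStarAlgHom.norm_apply_le (W t) b)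
          (norm_nonneg (W t a))])

theorem coe_vanishingAtInfinity :
    (vanishingAtInfinity W : Set A) = {a | ∀ ε : ℝ, 0 < ε → {t | ε ≤ ‖W t a‖}.Finite} :=
  TwoSidedIdeal.coe_mk' ..

/-- Representations are contractive, so an approximation of `a` within `ε / 2` is one of `W t a`
uniformly in `t`. -/
theorem isClosed_vanishingAtInfinity : IsClosed (vanishingAtInfinity W : Set A) := by
  rw [← closure_subset_iff_isClosed]
  intro a ha
  rw [coe_vanishingAtInfinity, Set.mem_ofPred_eq]
  intro ε hε
  obtain ⟨b, hb, hab⟩ := Metric.mem_closure_iff.1 ha _ (half_pos hε)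
  rw [coe_vanishingAtInfinity] at hb
  refine (hb _ (half_pos hε)).subset fun t ht => ?_
  rw [dist_eq_norm] at hab
  have h1 := NonUnitalStarAlgHom.norm_apply_le (W t) (a - b)
  rw [map_sub] at h1
  rw [Set.mem_ofPred_eq] at ht ⊢
  linarith [norm_sub_norm_le (W t a) (W t b)]

/-- An element of `J t` has at most one nonzero image, the one under `W t`, and decay at infinity
passes to the generated closed ideal. -/
theorem finite_norm_map_ge (hJ : ∀ t, IsElementary (J t).toSubalgebra)
    (hJne : ∀ s t, s ≠ t → J s ≠ J t) (hWirr : ∀ t, IsIrreducibleRep (W t))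
    (hWlift : ∀ t, LiftsIdeal (W t) (J t)) {j : A} (hj : j ∈ ClosedIdeal.generated J) {ε : ℝ}
    (hε : 0 < ε) : {t | ε ≤ ‖W t j‖}.Finite := by
  suffices h : j ∈ (vanishingAtInfinity W : Set A) by
    rw [coe_vanishingAtInfinity] at h
    exact h ε hε
  refine ClosedIdeal.mem_of_mem_generated isClosed_vanishingAtInfinity (fun t a ha => ?_) hj
  change a ∈ (vanishingAtInfinity W : Set A)
  rw [coe_vanishingAtInfinity]
  refine fun δ hδ => (Set.finite_singleton t).subset fun s hs => ?_
  by_contra hst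
  rw [Set.mem_ofPred_eq, map_eq_zero_of_ne hJ hJne hWirr hWlift hst ha, norm_zero] at hs
  exact absurd hs hδ.not_ge

/-- The restriction of a representation to an ideal which it maps into the compact operators. -/
noncomputable def StarAlgHom.restrictCompact {H : Type w} [NormedAddCommGroup H]
    [InnerProductSpace ℂ H] [CompleteSpace H] (W : A →⋆ₐ[ℂ] (H →L[ℂ] H)) (I : ClosedIdeal A)
    (h : ∀ a ∈ I, IsCompactOperator (W a)) : I.toSubalgebra →⋆ₙₐ[ℂ] compactOperators H :=
  NonUnitalStarAlgHom.codRestrict ((W : A →⋆ₙₐ[ℂ] (H →L[ℂ] H)).comp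
    (NonUnitalStarSubalgebraClass.subtype I.toSubalgebra)) (compactOperators H) fun j => h j j.2

theorem StarAlgHom.coe_restrictCompact {H : Type w} [NormedAddCommGroup H] [InnerProductSpace ℂ H]
    [CompleteSpace H] (W : A →⋆ₐ[ℂ] (H →L[ℂ] H)) (I : ClosedIdeal A)
    (h : ∀ a ∈ I, IsCompactOperator (W a)) (j : I.toSubalgebra) :
    (W.restrictCompact I h j : H →L[ℂ] H) = W j :=
  rfl

/-! ### The isomorphism onto the direct sum, and duality -/

/-- The product of the representations `W t` is an isomorphism of the generated ideal onto the
direct sum of the algebras of compact operators. -/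
theorem exists_starAlgEquiv_directSum_compactOperators
    (hJ : ∀ t, IsElementary (J t).toSubalgebra)
    (hJne : ∀ s t, s ≠ t → J s ≠ J t) (hWirr : ∀ t, IsIrreducibleRep (W t))
    (hWlift : ∀ t, LiftsIdeal (W t) (J t)) :
    ∃ Φ : (ClosedIdeal.generated J).toSubalgebra ≃⋆ₐ[ℂ]
        directSumCStar (fun t => compactOperators (H t)),
      ∀ (j : (ClosedIdeal.generated J).toSubalgebra) (t : T),
        (((Φ j : lp (fun t => compactOperators (H t)) ∞) t : compactOperators (H t)) :
          H t →L[ℂ] H t) = W t j := by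
  let ρ : ∀ t, (ClosedIdeal.generated J).toSubalgebra →⋆ₙₐ[ℂ] compactOperators (H t) := fun t =>
    (W t).restrictCompact _ fun j hj =>
      isCompactOperator_map_of_mem_generated hJ hJne hWirr hWlift hj t
  have hρ : ∀ t j, (ρ t j : H t →L[ℂ] H t) = W t j := fun t j => (W t).coe_restrictCompact _ _ j
  have hinj : ∀ j, (∀ t, ρ t j = 0) → j = 0 := fun j hj =>
    Subtype.ext (eq_zero_of_forall_map_eq_zero hWlift j.2 fun t => by rw [← hρ, hj]; rfl)
  have hfin : ∀ j, ∀ ε : ℝ, 0 < ε → {t | ε ≤ ‖ρ t j‖}.Finite := fun j ε hε =>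
    finite_norm_map_ge hJ hJne hWirr hWlift j.2 hε
  have hsurj : ∀ t (k : compactOperators (H t)), ∃ j, ρ t j = k ∧ ∀ s ≠ t, ρ s j = 0 := by
    intro t k
    obtain ⟨a, ha, hak⟩ := (hWirr t).exists_map_eq (hJ t) (hWlift t) k.2
    exact ⟨⟨a, ClosedIdeal.mem_generated_of_mem ha⟩, Subtype.ext hak, fun s hs =>
      Subtype.ext (map_eq_zero_of_ne hJ hJne hWirr hWlift hs ha)⟩
  have h := exists_starAlgEquiv_directSumCStar (B := (ClosedIdeal.generated J).toSubalgebra)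
    (K := fun t => compactOperators (H t)) ρ hinj hfin hsurj
  obtain ⟨Φ, hΦ⟩ := h
  have hΦW : ∀ (j : (ClosedIdeal.generated J).toSubalgebra) (t : T),
      (((Φ j : lp (fun t => compactOperators (H t)) ∞) t : compactOperators (H t)) :
        H t →L[ℂ] H t) = W t j := fun j t =>
    (congrArg Subtype.val (hΦ j t)).trans (hρ t j)
  exact ⟨Φ, hΦW⟩

/-- The generated ideal is isomorphic to the direct sum of the generating ideals. The index set is
replaced by the set of these ideals because of the universe of `T`. -/
theorem isDual_generated (hJ : ∀ t, IsElementary (J t).toSubalgebra)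
    (hJne : ∀ s t, s ≠ t → J s ≠ J t) (hWirr : ∀ t, IsIrreducibleRep (W t))
    (hWlift : ∀ t, LiftsIdeal (W t) (J t)) :
    IsDual (ClosedIdeal.generated J).toSubalgebra := by
  -- A section of `J`; it is a bijection onto `T` because the `J t` are distinct.
  choose τ hτ using fun i : Set.range J => i.2
  have hτinj : Function.Injective τ := fun i i' h => Subtype.ext (by rw [← hτ i, ← hτ i', h])
  have hτsurj : ∀ t, ∃ i, τ i = t := fun t => ⟨⟨J t, t, rfl⟩, by
    by_contra h
    exact hJne _ _ h (hτ _)⟩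
  let σ : ∀ t, (J t).toSubalgebra →⋆ₙₐ[ℂ] compactOperators (H t) := fun t =>
    (W t).restrictCompact _ fun j hj => (hWirr t).isCompactOperator_map (hJ t) (hWlift t) hj
  have hσ : ∀ t, Function.Bijective (σ t) := fun t =>
    ⟨fun a b hab => Subtype.ext (hWlift t a.2 b.2 (congrArg Subtype.val hab)), fun k => by
      obtain ⟨a, ha, hak⟩ := (hWirr t).exists_map_eq (hJ t) (hWlift t) k.2
      exact ⟨⟨a, ha⟩, Subtype.ext hak⟩⟩
  let e : ∀ t, (J t).toSubalgebra ≃⋆ₐ[ℂ] compactOperators (H t) := fun t =>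
    StarAlgEquiv.ofBijective (σ t) (hσ t)
  let π : ∀ t, (ClosedIdeal.generated J).toSubalgebra →⋆ₙₐ[ℂ] compactOperators (H t) := fun t =>
    (W t).restrictCompact _ fun j hj =>
      isCompactOperator_map_of_mem_generated hJ hJne hWirr hWlift hj t
  have hinj : ∀ j, (∀ i, π (τ i) j = 0) → j = 0 := fun j hj =>
    Subtype.ext (eq_zero_of_forall_map_eq_zero hWlift j.2 fun t => by
      obtain ⟨i, rfl⟩ := hτsurj t
      exact congrArg Subtype.val (hj i))
  have hfin : ∀ j, ∀ ε : ℝ, 0 < ε → {i | ε ≤ ‖π (τ i) j‖}.Finite := by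
    intro j ε hε
    have h := (finite_norm_map_ge hJ hJne hWirr hWlift j.2 hε).preimage hτinj.injOn
    exact h
  have hsurj : ∀ i (k : compactOperators (H (τ i))), ∃ j, π (τ i) j = k ∧
      ∀ i' ≠ i, π (τ i') j = 0 := by
    intro i k
    obtain ⟨a, ha, hak⟩ := (hWirr (τ i)).exists_map_eq (hJ (τ i)) (hWlift (τ i)) k.2
    exact ⟨⟨a, ClosedIdeal.mem_generated_of_mem ha⟩, Subtype.ext hak, fun i' hi' =>
      Subtype.ext (map_eq_zero_of_ne hJ hJne hWirr hWlift (hτinj.ne hi') ha)⟩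
  exact ⟨Set.range J, fun i => (J (τ i)).toSubalgebra, fun i => inferInstance, fun i => hJ (τ i),
    nonempty_starAlgEquiv_directSumCStar (B := (ClosedIdeal.generated J).toSubalgebra)
      (K := fun i => (J (τ i)).toSubalgebra) (C := fun i => compactOperators (H (τ i)))
      (fun i => e (τ i)) (fun i => π (τ i)) hinj hfin hsurj⟩

theorem exists_mem_generated_forall_map_eq (hJ : ∀ t, IsElementary (J t).toSubalgebra)
    (hJne : ∀ s t, s ≠ t → J s ≠ J t) (hWirr : ∀ t, IsIrreducibleRep (W t))
    (hWlift : ∀ t, LiftsIdeal (W t) (J t)) {k : ∀ t, H t →L[ℂ] H t}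
    (hk : ∀ t, IsCompactOperator (k t))
    (hfin : ∀ ε : ℝ, 0 < ε → {t | ε ≤ ‖k t‖}.Finite) :
    ∃ c ∈ ClosedIdeal.generated J, ∀ t, W t c = k t := by
  obtain ⟨Φ, hΦ⟩ := exists_starAlgEquiv_directSum_compactOperators hJ hJne hWirr hWlift
  have hmem : Memℓp (fun t => (⟨k t, hk t⟩ : compactOperators (H t))) ∞ := by
    refine memℓp_infty ?_
    -- Decay implies boundedness: only finitely many norms reach 1.
    obtain ⟨C, hC⟩ := ((hfin 1 one_pos).image fun t => ‖k t‖).bddAbove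
    refine ⟨max C 1, Set.forall_mem_range.2 fun t => ?_⟩
    rcases le_or_gt 1 ‖k t‖ with h | h
    · exact (hC ⟨t, h, rfl⟩).trans (le_max_left _ _)
    · exact h.le.trans (le_max_right _ _)
  let x : directSumCStar (fun t => compactOperators (H t)) := ⟨⟨_, hmem⟩, hfin⟩
  refine ⟨Φ.symm x, (Φ.symm x).2, fun t => ?_⟩
  rw [← hΦ, StarAlgEquiv.apply_symm_apply]

/-! ### Lifting of invertibility -/

/-- If all `W t a` are invertible and `a` is invertible modulo the generated ideal, then `a` has a
right inverse. -/
theorem exists_mul_eq_one (hJ : ∀ t, IsElementary (J t).toSubalgebra)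
    (hJne : ∀ s t, s ≠ t → J s ≠ J t) (hWirr : ∀ t, IsIrreducibleRep (W t))
    (hWlift : ∀ t, LiftsIdeal (W t) (J t)) {a b : A} (hab : a * b - 1 ∈ ClosedIdeal.generated J)
    (hba : b * a - 1 ∈ ClosedIdeal.generated J) (hW : ∀ t, IsUnit (W t a)) :
    ∃ c, a * c = 1 := by
  choose U hU using hW
  have hcpt : ∀ t, IsCompactOperator ((↑(U t)⁻¹ : H t →L[ℂ] H t) * W t (a * b - 1)) := fun t =>
    (isCompactOperator_map_of_mem_generated hJ hJne hWirr hWlift hab t).clm_comp _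
  have hfin : ∀ ε : ℝ, 0 < ε →
      {t | ε ≤ ‖(↑(U t)⁻¹ : H t →L[ℂ] H t) * W t (a * b - 1)‖}.Finite := by
    intro ε hε
    have hδ : 0 < ε / (2 * (‖b‖ + 1)) := by positivity
    refine ((finite_norm_map_ge hJ hJne hWirr hWlift hba one_half_pos).union
      (finite_norm_map_ge hJ hJne hWirr hWlift hab hδ)).subset fun t ht => ?_
    by_contra h
    simp only [Set.mem_union, Set.mem_ofPred_eq, not_or, not_le] at h ht
    obtain ⟨h₁, h₂⟩ := h
    set u : H t →L[ℂ] H t := ↑(U t)⁻¹ with hu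
    set k := W t (a * b - 1)
    have hau : W t a * u = 1 := by rw [← hU, hu, Units.mul_inv]
    -- No uniform bound on the inverses `u` is available. This identity absorbs `u * k` into the
    -- left side once `‖W t (b * a - 1)‖ < 1 / 2`, giving `‖u * k‖ ≤ 2 * ‖b‖ * ‖k‖`, whence the
    -- threshold `ε / (2 * (‖b‖ + 1))`.
    have heq : u * k = W t b * k - W t (b * a - 1) * (u * k) := by
      rw [map_sub, map_mul, map_one, sub_mul, one_mul, mul_assoc (W t b), ← mul_assoc (W t a), hau,
        one_mul, sub_sub_cancel]
    have h₃ : ‖u * k‖ ≤ ‖b‖ * ‖k‖ + 1 / 2 * ‖u * k‖ := by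
      calc ‖u * k‖ = ‖W t b * k - W t (b * a - 1) * (u * k)‖ := by rw [← heq]
        _ ≤ ‖W t b‖ * ‖k‖ + ‖W t (b * a - 1)‖ * ‖u * k‖ :=
          (norm_sub_le _ _).trans (add_le_add (norm_mul_le _ _) (norm_mul_le _ _))
        _ ≤ _ := by
          gcongr
          exact NonUnitalStarAlgHom.norm_apply_le (W t) b
    rw [lt_div_iff₀ (by positivity)] at h₂
    nlinarith [norm_nonneg k]
  obtain ⟨c, hc, hcW⟩ := exists_mem_generated_forall_map_eq hJ hJne hWirr hWlift hcpt hfin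
  refine ⟨b - c, ?_⟩
  have hz : a * c - (a * b - 1) = 0 := by
    refine eq_zero_of_forall_map_eq_zero hWlift ((ClosedIdeal.generated J).toTwoSidedIdeal.sub_mem
      ((ClosedIdeal.generated J).toTwoSidedIdeal.mul_mem_left _ _ hc) hab) fun t => ?_
    rw [map_sub, map_mul, hcW, ← hU, Units.mul_inv_cancel_left, sub_self]
  rw [mul_sub, sub_eq_zero.1 hz, sub_sub_cancel]

/-- The hypotheses are stable under the involution, so `star a` also has a right inverse, whose
adjoint is a left inverse of `a`. -/
theorem isUnit_of_isUnitModulo (hJ : ∀ t, IsElementary (J t).toSubalgebra)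
    (hJne : ∀ s t, s ≠ t → J s ≠ J t) (hWirr : ∀ t, IsIrreducibleRep (W t))
    (hWlift : ∀ t, LiftsIdeal (W t) (J t)) {a : A}
    (ha : (ClosedIdeal.generated J).IsUnitModulo a) (hW : ∀ t, IsUnit (W t a)) : IsUnit a := by
  obtain ⟨b, hab, hba⟩ := ClosedIdeal.isUnitModulo_iff.1 ha
  obtain ⟨c, hc⟩ := exists_mul_eq_one hJ hJne hWirr hWlift hab hba hW
  have hstar : ∀ {x y : A}, x * y - 1 ∈ ClosedIdeal.generated J →
      star y * star x - 1 ∈ ClosedIdeal.generated J := fun {x y} h => by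
    have h' := star_mem_of_isClosed _ (ClosedIdeal.generated J).isClosed h
    rwa [star_sub, star_mul, star_one] at h'
  obtain ⟨d, hd⟩ := exists_mul_eq_one hJ hJne hWirr hWlift (hstar hba) (hstar hab) fun t => by
    rw [map_star]
    exact (hW t).star
  have hd' : star d * a = 1 := by
    rw [← star_star a, ← star_mul, hd, star_one]
  exact isUnit_iff_exists.2 ⟨c, hc, by rwa [← left_inv_eq_right_inv hd' hc]⟩

/-- For all but finitely many `t`, both `W t (a * b)` and `W t (b * a)` are within distance 1 of the
identity, hence invertible, so `W t a` has inverses on both sides. -/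
theorem finite_not_isUnit_map (hJ : ∀ t, IsElementary (J t).toSubalgebra)
    (hJne : ∀ s t, s ≠ t → J s ≠ J t) (hWirr : ∀ t, IsIrreducibleRep (W t))
    (hWlift : ∀ t, LiftsIdeal (W t) (J t)) {a b : A} (hab : a * b - 1 ∈ ClosedIdeal.generated J)
    (hba : b * a - 1 ∈ ClosedIdeal.generated J) : {t | ¬ IsUnit (W t a)}.Finite := by
  refine ((finite_norm_map_ge hJ hJne hWirr hWlift hab one_pos).union
    (finite_norm_map_ge hJ hJne hWirr hWlift hba one_pos)).subset fun t ht => ?_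
  by_contra h
  simp only [Set.mem_union, Set.mem_ofPred_eq, not_or, not_le] at h ht
  have hunit : ∀ {x : A}, ‖W t (x - 1)‖ < 1 → IsUnit (W t x) := fun {x} hx => by
    rw [← norm_neg] at hx
    have := isUnit_one_sub_of_norm_lt_one hx
    rwa [map_sub, map_one, neg_sub, sub_sub_cancel] at this
  obtain ⟨u, hu⟩ := hunit h.1
  obtain ⟨v, hv⟩ := hunit h.2
  rw [map_mul] at hu hv
  have hr : W t a * (W t b * ↑u⁻¹) = 1 := by rw [← mul_assoc, ← hu, Units.mul_inv]
  have hl : (↑v⁻¹ * W t b) * W t a = 1 := by rw [mul_assoc, ← hv, Units.inv_mul]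
  exact ht (isUnit_iff_exists.2 ⟨_, hr, by rwa [← left_inv_eq_right_inv hl hr]⟩)

end Family

/-! ### The lifting theorem -/

theorem theorem3 {A : Type u} [CStarAlgebra A] {T : Type v}
    (J : T → ClosedIdeal A)
    (hJ : ∀ t, IsElementary (J t).toSubalgebra)
    (hJne : ∀ s t, s ≠ t → J s ≠ J t)
    (H : T → Type w) [∀ t, NormedAddCommGroup (H t)] [∀ t, InnerProductSpace ℂ (H t)]
    [∀ t, CompleteSpace (H t)]
    (W : ∀ t, A →⋆ₐ[ℂ] (H t →L[ℂ] H t))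
    (hWirr : ∀ t, IsIrreducibleRep (W t))
    (hWlift : ∀ t, LiftsIdeal (W t) (J t)) :
    -- the closed ideal generated by the `J t` is dual
    IsDual (ClosedIdeal.generated J).toSubalgebra ∧
    -- the family lifts invertibility
    (∀ a : A, IsUnit a ↔
      (ClosedIdeal.generated J).IsUnitModulo a ∧ ∀ t, IsUnit (W t a)) ∧
    -- the intersection of a finite sum of the ideals with another one of them is zero
    (∀ (s : Finset T) (t : T), t ∉ s → ∀ x : T → A, (∀ r ∈ s, x r ∈ J r) →
      ∑ r ∈ s, x r ∈ J t → ∑ r ∈ s, x r = 0) ∧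
    -- separation property
    (∀ s t : T, s ≠ t → ∀ a ∈ J t, W s a = 0) ∧
    -- compactness, and norms vanishing at infinity
    (∀ j ∈ ClosedIdeal.generated J, (∀ t, IsCompactOperator (W t j)) ∧
      ∀ ε : ℝ, 0 < ε → {t | ε ≤ ‖W t j‖}.Finite) ∧
    -- Fredholmness of the images of elements that are invertible modulo the ideal
    (∀ a : A, (ClosedIdeal.generated J).IsUnitModulo a →
      (∀ t, (W t a).IsFredholm) ∧ {t | ¬ IsUnit (W t a)}.Finite) ∧
    -- the product of the `W t` is a ⋆-isomorphism of the ideal onto the sum of the `K(H t)`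
    (∃ Φ : (ClosedIdeal.generated J).toSubalgebra ≃⋆ₐ[ℂ]
        directSumCStar (fun t => compactOperators (H t)),
      ∀ (j : (ClosedIdeal.generated J).toSubalgebra) (t : T),
        (((Φ j : lp (fun t => compactOperators (H t)) ∞) t : compactOperators (H t)) :
          H t →L[ℂ] H t) = W t j) := by
  refine ⟨isDual_generated hJ hJne hWirr hWlift, fun a => ⟨fun ha => ⟨?_, fun t => ha.map (W t)⟩,
    fun ha => isUnit_of_isUnitModulo hJ hJne hWirr hWlift ha.1 ha.2⟩, ?_,
    fun s t hst a ha => map_eq_zero_of_ne hJ hJne hWirr hWlift hst ha,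
    fun j hj => ⟨isCompactOperator_map_of_mem_generated hJ hJne hWirr hWlift hj,
      fun ε hε => finite_norm_map_ge hJ hJne hWirr hWlift hj hε⟩, ?_,
    exists_starAlgEquiv_directSum_compactOperators hJ hJne hWirr hWlift⟩
  · exact ha.map (ClosedIdeal.generated J).toTwoSidedIdeal.ringCon.mk'
  · intro s t hts x hx hsum
    -- `W t` is injective on `J t`, where the sum lies, and kills every summand.
    refine hWlift t hsum (J t).toTwoSidedIdeal.zero_mem ?_
    rw [map_sum, map_zero]
    exact Finset.sum_eq_zero fun r hr => map_eq_zero_of_ne hJ hJne hWirr hWlift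
      (fun h : t = r => hts (h ▸ hr)) (hx r hr)
  · intro a ha
    obtain ⟨b, hab, hba⟩ := ClosedIdeal.isUnitModulo_iff.1 ha
    refine ⟨fun t => ContinuousLinearMap.isFredholm_of_isCompactOperator (b := W t b) ?_ ?_,
      finite_not_isUnit_map hJ hJne hWirr hWlift hab hba⟩
    · simpa using isCompactOperator_map_of_mem_generated hJ hJne hWirr hWlift hab t
    · simpa using isCompactOperator_map_of_mem_generated hJ hJne hWirr hWlift hba t
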